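/- Let $G$ be a cotorsion group, i.e. an abelian group with $\operatorname{Ext}(\mathbb{Q},G)=0$, meaning that every short exact sequence of abelian groups $0\to G\to B\to\mathbb{Q}\to 0$ is equivalent to the split one. For an abelian group $A$ define the Ulm subgroups recursively by $A^0:=A$, $A^{\mu+1}:=\bigcap_{n\ge 1} nA^{\mu}$ for every ordinal $\mu$, and $A^{\delta}:=\bigcap_{\mu<\delta}A^{\mu}$ for every limit ordinal $\delta$; the Ulm length $u(A)$ is the smallest ordinal $\mu$ with $A^{\mu+1}=A^{\mu}$. For a prime $p$ define similarly $p^0A:=A$, $p^{\mu+1}A:=p(p^{\mu}A)$, and $p^{\delta}A:=\bigcap_{\mu<\delta}p^{\mu}A$ for every limit ordinal $\delta$; the $p$-length $l_p(A)$ is the smallest ordinal $\mu$ with $p^{\mu+1}A=p^{\mu}A$. Then, for every ordinal $\lambda$, $u(G)\le\lambda$ if and only if $l_p(G)\le\omega\lambda$ for every prime $p$. -/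

import Mathlib

universe u

/-- A short exact sequence `0 → A → B → C → 0` of abelian groups. The middle group may be taken in
the universe of `A`, since it is in bijection with `A × C`. -/
structure AbExtension (C : Type) (A : Type u) [AddCommGroup C] [AddCommGroup A] where
  /-- the middle group -/
  B : Type u
  [addCommGroup : AddCommGroup B]
  /-- the map `A → B` -/
  f : A →+ B
  /-- the map `B → C` -/
  g : B →+ C
  injective : Function.Injective f
  exact : Function.Exact f g
  surjective : Function.Surjective g

attribute [instance] AbExtension.addCommGroup

namespace AbExtension

variable {C : Type} {A : Type u} [AddCommGroup C] [AddCommGroup A]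

/-- Equivalence of extensions: an isomorphism of the middle groups that commutes with the maps
from `A` and the maps to `C`. -/
def Equivalent (E E' : AbExtension C A) : Prop :=
  ∃ e : E.B ≃+ E'.B, (∀ a, e (E.f a) = E'.f a) ∧ ∀ b, E'.g (e b) = E.g b

variable (C A) in
/-- The split extension `0 → A → A ⊕ C → C → 0`, the zero element of `Ext(C, A)`. -/
def split : AbExtension C A where
  B := A × C
  f := AddMonoidHom.inl A C
  g := AddMonoidHom.snd A C
  injective := fun a b h => congrArg Prod.fst h
  exact := by
    rintro ⟨a, c⟩
    constructor
    · intro h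
      exact ⟨a, Prod.ext rfl (Eq.symm h)⟩
    · rintro ⟨a', h⟩
      exact (congrArg Prod.snd h).symm
  surjective := fun c => ⟨(0, c), rfl⟩

end AbExtension

/-- `G` is cotorsion if `Ext(ℚ, G) = 0`: every extension of `ℚ` by `G` is equivalent to the split
extension. -/
def IsCotorsion (G : Type u) [AddCommGroup G] : Prop :=
  ∀ E : AbExtension ℚ G, E.Equivalent (AbExtension.split ℚ G)

section Filtrations

variable {A : Type u} [AddCommGroup A]

/-- The subgroup `n H = {n h | h ∈ H}`. -/
def mulSubgroup (n : ℕ) (H : AddSubgroup A) : AddSubgroup A :=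
  H.map (nsmulAddMonoidHom n)

theorem mem_mulSubgroup {n : ℕ} {H : AddSubgroup A} {x : A} :
    x ∈ mulSubgroup n H ↔ ∃ h ∈ H, n • h = x := Iff.rfl

theorem mulSubgroup_le (n : ℕ) (H : AddSubgroup A) : mulSubgroup n H ≤ H := by
  rintro _ ⟨h, hh, rfl⟩
  exact H.nsmul_mem hh n

/-- Transfinite iteration of an operation `F` on subgroups of `A`, starting at `A`, with
intersections at limit ordinals. -/
noncomputable def transIter (F : AddSubgroup A → AddSubgroup A) (o : Ordinal.{u}) :
    AddSubgroup A :=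
  Ordinal.limitRecOn o ⊤ (fun _ H => F H) (fun o _ ih => ⨅ (o' : Ordinal.{u}) (h : o' < o), ih o' h)

variable (F : AddSubgroup A → AddSubgroup A)

theorem transIter_zero : transIter F 0 = ⊤ := Ordinal.limitRecOn_zero ..

theorem transIter_add_one (o : Ordinal.{u}) : transIter F (o + 1) = F (transIter F o) :=
  Ordinal.limitRecOn_add_one ..

theorem transIter_limit {o : Ordinal.{u}} (ho : Order.IsSuccLimit o) :
    transIter F o = ⨅ (o' : Ordinal.{u}) (_ : o' < o), transIter F o' :=
  Ordinal.limitRecOn_limit (h := ho) ..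

variable {F} in
theorem transIter_antitone (hF : ∀ H, F H ≤ H) : Antitone (transIter F) := by
  intro a b
  induction b using Ordinal.limitRecOn with
  | zero =>
    intro h
    rw [nonpos_iff_eq_zero.mp h]
  | add_one b ih =>
    intro h
    rcases h.eq_or_lt with rfl | h
    · exact le_rfl
    · rw [transIter_add_one]
      exact (hF _).trans (ih (Order.lt_add_one_iff.mp h))
  | limit b hb ih =>
    intro h
    rcases h.eq_or_lt with rfl | h
    · exact le_rfl
    · rw [transIter_limit F hb]
      exact iInf₂_le a h

variable {F} in
theorem transIter_stabilizes (hF : ∀ H, F H ≤ H) :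
    {o : Ordinal.{u} | transIter F (o + 1) = transIter F o}.Nonempty := by
  have hni := not_injective_of_ordinal (transIter F)
  simp only [Function.Injective, not_forall] at hni
  obtain ⟨a, b, hab, hne⟩ := hni
  have key : ∀ a b : Ordinal.{u}, a < b → transIter F a = transIter F b →
      transIter F (a + 1) = transIter F a := fun a b hlt h =>
    le_antisymm (transIter_antitone hF (Order.le_succ a))
      (h.le.trans (transIter_antitone hF (Order.add_one_le_of_lt hlt)))
  rcases lt_or_gt_of_ne hne with hlt | hlt
  · exact ⟨a, key a b hlt hab⟩
  · exact ⟨b, key b a hlt hab.symm⟩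

end Filtrations

section Lengths

variable (A : Type u) [AddCommGroup A]

/-- The Ulm subgroups: `A^0 = A`, `A^(o+1) = ⋂_{n ≥ 1} n A^o`, intersections at limits. -/
noncomputable def ulmSubgroup (o : Ordinal.{u}) : AddSubgroup A :=
  transIter (fun H => ⨅ (n : ℕ) (_ : 1 ≤ n), mulSubgroup n H) o

/-- The subgroups `p^o A`: `p^0 A = A`, `p^(o+1) A = p (p^o A)`, intersections at limits. -/
noncomputable def pPowSubgroup (p : ℕ) (o : Ordinal.{u}) : AddSubgroup A :=
  transIter (mulSubgroup p) o

theorem ulmSubgroup_stabilizes :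
    {o : Ordinal.{u} | ulmSubgroup A (o + 1) = ulmSubgroup A o}.Nonempty :=
  transIter_stabilizes fun H => (iInf₂_le 1 le_rfl).trans (mulSubgroup_le 1 H)

theorem pPowSubgroup_stabilizes (p : ℕ) :
    {o : Ordinal.{u} | pPowSubgroup A p (o + 1) = pPowSubgroup A p o}.Nonempty :=
  transIter_stabilizes (mulSubgroup_le p)

/-- The Ulm length `u(A)`: the smallest ordinal `o` with `A^(o+1) = A^o`
(there is one by `ulmSubgroup_stabilizes`). -/
noncomputable def ulmLength : Ordinal.{u} :=
  sInf {o : Ordinal.{u} | ulmSubgroup A (o + 1) = ulmSubgroup A o}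

/-- The `p`-length `l_p(A)`: the smallest ordinal `o` with `p^(o+1) A = p^o A`
(there is one by `pPowSubgroup_stabilizes`). -/
noncomputable def pLength (p : ℕ) : Ordinal.{u} :=
  sInf {o : Ordinal.{u} | pPowSubgroup A p (o + 1) = pPowSubgroup A p o}

end Lengths

/-!
For every abelian group `A` the Ulm subgroup `A^o` is the intersection of the subgroups `p^(ω o) A`
over all primes `p`, so bounds on the `p`-lengths give one on the Ulm length.

For the converse, push out the extension `0 → ℤ → ℤ[1/p] ⊕ ℤ_(p) → ℚ → 0` along `1 ↦ x ∈ G`. As `G`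
is cotorsion the result splits, so `x` is a sum of images of `1` under homomorphisms from `ℤ[1/p]`
and from `ℤ_(p)`. Hence `G = D + K` with `D` divisible by `p` and `K` by all other primes. Since
`D ≤ p^(ω o) G`, the modular law gives `p^(ω o) G = D + G^o`; if `G^o` is divisible, this is
`p`-divisible.
-/

section TransfiniteIteration

variable {A : Type u} [AddCommGroup A] {F : AddSubgroup A → AddSubgroup A}

theorem transIter_induction {P : AddSubgroup A → Prop} (top : P ⊤) (apply : ∀ H, P H → P (F H))
    (sInf : ∀ s : Set (AddSubgroup A), (∀ H ∈ s, P H) → P (sInf s)) (o : Ordinal.{u}) :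
    P (transIter F o) := by
  induction o using Ordinal.limitRecOn with
  | zero => rwa [transIter_zero]
  | add_one o ih =>
    rw [transIter_add_one]
    exact apply _ ih
  | limit o ho ih =>
    have h := sInf (transIter F '' Set.Iio o) (Set.forall_mem_image.mpr ih)
    rw [sInf_image] at h
    rwa [transIter_limit F ho]

theorem le_transIter (hF : Monotone F) {D : AddSubgroup A} (hD : D ≤ F D) (o : Ordinal.{u}) :
    D ≤ transIter F o :=
  transIter_induction le_top (fun _ h => hD.trans (hF h)) (fun _ => le_sInf) o

theorem transIter_eq_of_le (hF : ∀ H, F H ≤ H) {m o : Ordinal.{u}}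
    (hm : transIter F (m + 1) = transIter F m) (ho : m ≤ o) : transIter F o = transIter F m := by
  refine le_antisymm (transIter_antitone hF ho) ?_
  rw [transIter_add_one] at hm
  induction o using Ordinal.limitRecOn with
  | zero => exact transIter_antitone hF zero_le
  | add_one b ih =>
    rcases ho.eq_or_lt with rfl | h
    · exact le_rfl
    · have hb : transIter F b = transIter F m :=
        le_antisymm (transIter_antitone hF (Order.lt_add_one_iff.mp h))
          (ih (Order.lt_add_one_iff.mp h))
      rw [transIter_add_one, hb, hm]
  | limit b hb ih =>
    rw [transIter_limit F hb]
    refine le_iInf₂ fun c hc => ?_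
    rcases le_total m c with h | h
    · exact ih c hc h
    · exact transIter_antitone hF h

theorem sInf_transIter_stable_le_iff (hF : ∀ H, F H ≤ H) {o : Ordinal.{u}} :
    sInf {a : Ordinal.{u} | transIter F (a + 1) = transIter F a} ≤ o ↔
      transIter F (o + 1) = transIter F o := by
  refine ⟨fun h => ?_, fun h => csInf_le' h⟩
  have hm := csInf_mem (transIter_stabilizes hF)
  rw [transIter_eq_of_le hF hm h, transIter_eq_of_le hF hm (h.trans le_self_add)]

theorem transIter_isNormal_apply (hF : ∀ H, F H ≤ H) {g : Ordinal.{u} → Ordinal.{u}}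
    (hg : Order.IsNormal g) {o : Ordinal.{u}} (ho : Order.IsSuccLimit o) :
    transIter F (g o) = ⨅ (a : Ordinal.{u}) (_ : a < o), transIter F (g a) := by
  refine le_antisymm (le_iInf₂ fun a ha => transIter_antitone hF (hg.monotone ha.le)) ?_
  rw [transIter_limit F (hg.map_isSuccLimit ho)]
  refine le_iInf₂ fun b hb => ?_
  obtain ⟨a, ha, hba⟩ := (hg.lt_iff_exists_lt ho).mp hb
  exact (iInf₂_le a ha).trans (transIter_antitone hF hba.le)

end TransfiniteIteration

section Multiples

variable {A : Type u} [AddCommGroup A] {m n : ℕ} {H : AddSubgroup A}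

theorem mulSubgroup_mono (n : ℕ) : Monotone (mulSubgroup n : AddSubgroup A → AddSubgroup A) :=
  fun _ _ => AddSubgroup.map_mono

theorem mulSubgroup_one (H : AddSubgroup A) : mulSubgroup 1 H = H := by
  ext x
  simp only [mem_mulSubgroup, one_nsmul, exists_eq_right]

theorem mulSubgroup_mul (m n : ℕ) (H : AddSubgroup A) :
    mulSubgroup (m * n) H = mulSubgroup m (mulSubgroup n H) := by
  ext x
  simp only [mem_mulSubgroup, mul_nsmul', exists_exists_and_eq_and]

theorem mem_mulSubgroup_of_coprime (h : m.Coprime n) {y : A} (hy : y ∈ H)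
    (hny : n • y ∈ mulSubgroup m H) : y ∈ mulSubgroup m H := by
  obtain ⟨a, b, hab⟩ : IsCoprime (m : ℤ) n := Nat.isCoprime_iff_coprime.mpr h
  have hmy : m • y ∈ mulSubgroup m H := ⟨y, hy, rfl⟩
  have hy_eq : y = a • m • y + b • n • y := by
    rw [← natCast_zsmul, ← natCast_zsmul, smul_smul, smul_smul, ← add_smul, hab, one_smul]
  rw [hy_eq]
  exact add_mem (zsmul_mem hmy a) (zsmul_mem hny b)

theorem mulSubgroup_mul_of_coprime (h : m.Coprime n) (H : AddSubgroup A) :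
    mulSubgroup (m * n) H = mulSubgroup m H ⊓ mulSubgroup n H := by
  refine le_antisymm (le_inf ?_ ?_) ?_
  · rw [mulSubgroup_mul]
    exact mulSubgroup_mono m (mulSubgroup_le n H)
  · rw [mul_comm, mulSubgroup_mul]
    exact mulSubgroup_mono n (mulSubgroup_le m H)
  · rintro _ ⟨⟨y, hy, rfl⟩, hn⟩
    rw [mulSubgroup_mul]
    exact ⟨y, mem_mulSubgroup_of_coprime h.symm hy hn, rfl⟩

theorem iInf_mulSubgroup_eq_iInf_prime_pow (H : AddSubgroup A) :
    ⨅ (n : ℕ) (_ : 1 ≤ n), mulSubgroup n H =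
      ⨅ (p : ℕ) (_ : p.Prime) (k : ℕ), mulSubgroup (p ^ k) H := by
  refine le_antisymm ?_ (le_iInf fun n => ?_)
  · exact le_iInf₂ fun p hp => le_iInf fun k => iInf₂_le (p ^ k) (Nat.one_le_pow _ _ hp.pos)
  · induction n using Nat.recOnPosPrimePosCoprime with
    | prime_pow p k hp _ => exact le_iInf fun _ => (iInf₂_le p hp).trans (iInf_le _ k)
    | zero => exact le_iInf fun h => absurd h (by decide)
    | one =>
      rw [mulSubgroup_one]
      exact le_iInf fun _ => (iInf₂_le 2 Nat.prime_two).trans ((iInf_le _ 0).trans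
        (mulSubgroup_le _ H))
    | coprime a b ha hb hab iha ihb =>
      rw [mulSubgroup_mul_of_coprime hab]
      exact le_iInf fun _ => le_inf (iha.trans (iInf_le _ ha.le)) (ihb.trans (iInf_le _ hb.le))

/- If `x = p ^ k • y` with `y ∈ H p`, then `y` lies in the other `H q` too, because `x` does and
`p ^ k` is prime to `q`. -/
theorem iInf_mulSubgroup_iInf_prime {H : ℕ → AddSubgroup A}
    (hH : ∀ p : ℕ, p.Prime → ∀ n : ℕ, p.Coprime n → ∀ y : A, n • y ∈ H p → y ∈ H p) :
    ⨅ (n : ℕ) (_ : 1 ≤ n), mulSubgroup n (⨅ (p : ℕ) (_ : p.Prime), H p) =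
      ⨅ (p : ℕ) (_ : p.Prime) (k : ℕ), mulSubgroup (p ^ k) (H p) := by
  rw [iInf_mulSubgroup_eq_iInf_prime_pow]
  refine le_antisymm (iInf₂_mono fun p hp => iInf_mono fun k =>
    mulSubgroup_mono _ (iInf₂_le p hp)) fun x hx => ?_
  simp only [AddSubgroup.mem_iInf] at hx ⊢
  intro p hp k
  obtain ⟨y, hy, rfl⟩ := hx p hp k
  refine ⟨y, ?_, rfl⟩
  simp only [SetLike.mem_coe, AddSubgroup.mem_iInf]
  intro q hq
  rcases eq_or_ne q p with rfl | hqp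
  · exact hy
  · exact hH q hq (p ^ k) (((Nat.coprime_primes hq hp).mpr hqp).pow_right k) y
      (mulSubgroup_le _ _ (hx q hq 0))

end Multiples

section UlmSubgroups

variable {A : Type u} [AddCommGroup A] {p : ℕ} {o : Ordinal.{u}}

theorem ulmSubgroup_add_one (o : Ordinal.{u}) :
    ulmSubgroup A (o + 1) = ⨅ (n : ℕ) (_ : 1 ≤ n), mulSubgroup n (ulmSubgroup A o) :=
  transIter_add_one _ o

theorem pPowSubgroup_add_one (p : ℕ) (o : Ordinal.{u}) :
    pPowSubgroup A p (o + 1) = mulSubgroup p (pPowSubgroup A p o) :=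
  transIter_add_one _ o

theorem ulmLength_le_iff : ulmLength A ≤ o ↔ ulmSubgroup A (o + 1) = ulmSubgroup A o :=
  sInf_transIter_stable_le_iff fun H => (iInf₂_le 1 le_rfl).trans (mulSubgroup_le 1 H)

theorem pLength_le_iff : pLength A p ≤ o ↔ pPowSubgroup A p (o + 1) = pPowSubgroup A p o :=
  sInf_transIter_stable_le_iff (mulSubgroup_le p)

theorem pPowSubgroup_eq_of_pLength_le {m : Ordinal.{u}} (hm : pLength A p ≤ m) (ho : m ≤ o) :
    pPowSubgroup A p o = pPowSubgroup A p m :=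
  transIter_eq_of_le (mulSubgroup_le p) (pLength_le_iff.mp hm) ho

theorem mem_pPowSubgroup_of_coprime {n : ℕ} (h : p.Coprime n) (o : Ordinal.{u}) (y : A) :
    n • y ∈ pPowSubgroup A p o → y ∈ pPowSubgroup A p o := by
  refine transIter_induction (P := fun H => ∀ y : A, n • y ∈ H → y ∈ H)
    (fun y _ => AddSubgroup.mem_top y) ?_ ?_ o y
  · exact fun H ih y hy => mem_mulSubgroup_of_coprime h (ih y (mulSubgroup_le p H hy)) hy
  · exact fun s ih y hy => AddSubgroup.mem_sInf.mpr fun H hH =>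
      ih H hH y (AddSubgroup.mem_sInf.mp hy H hH)

theorem pPowSubgroup_add_natCast (p : ℕ) (o : Ordinal.{u}) (k : ℕ) :
    pPowSubgroup A p (o + k) = mulSubgroup (p ^ k) (pPowSubgroup A p o) := by
  induction k with
  | zero => rw [Nat.cast_zero, add_zero, pow_zero, mulSubgroup_one]
  | succ k ih =>
    rw [Nat.cast_succ, ← add_assoc, pPowSubgroup_add_one, ih, pow_succ', mulSubgroup_mul]

theorem pPowSubgroup_add_omega0 (p : ℕ) (o : Ordinal.{u}) :
    pPowSubgroup A p (o + Ordinal.omega0) =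
      ⨅ k : ℕ, mulSubgroup (p ^ k) (pPowSubgroup A p o) := by
  have hω : pPowSubgroup A p (o + Ordinal.omega0) =
      ⨅ (a : Ordinal.{u}) (_ : a < Ordinal.omega0), pPowSubgroup A p (o + a) :=
    transIter_isNormal_apply (mulSubgroup_le p) (Ordinal.isNormal_add_right o)
      Ordinal.isSuccLimit_omega0
  simp only [hω, ← pPowSubgroup_add_natCast]
  refine le_antisymm (le_iInf fun k => ?_) (le_iInf₂ fun a ha => ?_)
  · exact iInf₂_le (k : Ordinal.{u}) (Ordinal.natCast_lt_omega0 k)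
  · obtain ⟨k, rfl⟩ := Ordinal.lt_omega0.mp ha
    exact iInf_le _ k

theorem ulmSubgroup_eq_iInf_pPowSubgroup (o : Ordinal.{u}) :
    ulmSubgroup A o = ⨅ (p : ℕ) (_ : p.Prime), pPowSubgroup A p (Ordinal.omega0 * o) := by
  induction o using Ordinal.limitRecOn with
  | zero => simp only [ulmSubgroup, pPowSubgroup, mul_zero, transIter_zero, iInf_top]
  | add_one o ih =>
    rw [ulmSubgroup_add_one, ih, iInf_mulSubgroup_iInf_prime fun p _ n h y =>
      mem_pPowSubgroup_of_coprime h _ y]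
    simp only [mul_add_one, pPowSubgroup_add_omega0]
  | limit o ho ih =>
    have hp : ∀ p : ℕ, pPowSubgroup A p (Ordinal.omega0 * o) =
        ⨅ (a : Ordinal.{u}) (_ : a < o), pPowSubgroup A p (Ordinal.omega0 * a) := fun p =>
      transIter_isNormal_apply (mulSubgroup_le p) (Ordinal.isNormal_mul_right Ordinal.omega0_pos) ho
    rw [ulmSubgroup, transIter_limit _ ho]
    simp only [hp]
    rw [iInf₂_comm]
    exact biInf_congr ih

theorem ulmSubgroup_le_pPowSubgroup (hp : p.Prime) (o : Ordinal.{u}) :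
    ulmSubgroup A o ≤ pPowSubgroup A p (Ordinal.omega0 * o) :=
  (ulmSubgroup_eq_iInf_pPowSubgroup o).le.trans (iInf₂_le p hp)

theorem ulmLength_le_of_forall_pLength_le
    (h : ∀ p : ℕ, p.Prime → pLength A p ≤ Ordinal.omega0 * o) : ulmLength A ≤ o := by
  rw [ulmLength_le_iff, ulmSubgroup_eq_iInf_pPowSubgroup, ulmSubgroup_eq_iInf_pPowSubgroup]
  exact biInf_congr fun p hp =>
    pPowSubgroup_eq_of_pLength_le (h p hp) (mul_le_mul_right (Order.le_succ o) _)

end UlmSubgroups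

namespace AbExtension

theorem Equivalent.exists_retraction {C : Type} {A : Type u} [AddCommGroup C] [AddCommGroup A]
    {E : AbExtension C A} (h : E.Equivalent (split C A)) :
    ∃ ρ : E.B →+ A, ∀ a, ρ (E.f a) = a := by
  obtain ⟨e, he, -⟩ := h
  exact ⟨(AddMonoidHom.fst A C).comp e.toAddMonoidHom, fun a => congrArg Prod.fst (he a)⟩

section Pushout

universe v

variable {C : Type} {A : Type v} {G : Type max u v}
variable [AddCommGroup C] [AddCommGroup A] [AddCommGroup G]

/-- The pushout of an extension of `C` by `A` along `φ : A → G`: its middle group is the quotient of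
`G ⊕ B` by the elements `(φ a, -f a)`. -/
def pushout (E : AbExtension C A) (φ : A →+ G) : AbExtension C G where
  B := (G × E.B) ⧸ (φ.prod (-E.f)).range
  f := (QuotientAddGroup.mk' _).comp (AddMonoidHom.inl G E.B)
  g := QuotientAddGroup.lift _ (E.g.comp (AddMonoidHom.snd G E.B)) <| by
    rintro _ ⟨a, rfl⟩
    simp [E.exact.apply_apply_eq_zero]
  injective := by
    rw [injective_iff_map_eq_zero]
    intro x hx
    obtain ⟨a, ha⟩ := (QuotientAddGroup.eq_zero_iff _).mp hx
    obtain ⟨hφ, hf⟩ : φ a = x ∧ -E.f a = 0 := Prod.ext_iff.mp ha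
    rw [← hφ, (injective_iff_map_eq_zero E.f).mp E.injective a (neg_eq_zero.mp hf), map_zero]
  exact := by
    intro z
    constructor
    · induction z using QuotientAddGroup.induction_on with
      | H t =>
        obtain ⟨x, b⟩ := t
        intro hb
        obtain ⟨a, rfl⟩ := (E.exact b).mp hb
        refine ⟨x + φ a, QuotientAddGroup.eq.mpr ⟨-a, ?_⟩⟩
        simp
    · rintro ⟨x, rfl⟩
      exact map_zero E.g
  surjective := fun c => by
    obtain ⟨b, hb⟩ := E.surjective c
    exact ⟨QuotientAddGroup.mk' _ (0, b), hb⟩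

/-- The map from the middle group of an extension to that of its pushout. -/
def toPushout (E : AbExtension C A) (φ : A →+ G) : E.B →+ (E.pushout φ).B :=
  (QuotientAddGroup.mk' _).comp (AddMonoidHom.inr G E.B)

theorem toPushout_f (E : AbExtension C A) (φ : A →+ G) (a : A) :
    E.toPushout φ (E.f a) = (E.pushout φ).f (φ a) :=
  QuotientAddGroup.eq.mpr ⟨a, by simp⟩

end Pushout

/-- The extension `0 → P ⊓ L → P ⊕ L → C → 0` for subgroups `P` and `L` with `P + L = C`, whose maps
are the diagonal and the difference. -/
def ofSupEqTop {C : Type} [AddCommGroup C] (P L : AddSubgroup C) (h : P ⊔ L = ⊤) :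
    AbExtension C ↥(P ⊓ L) where
  B := P × L
  f := (AddSubgroup.inclusion inf_le_left).prod (AddSubgroup.inclusion inf_le_right)
  g := P.subtype.coprod (-L.subtype)
  injective := fun r s hrs => Subtype.ext (congrArg (fun t : P × L => (t.1 : C)) hrs)
  exact := by
    rintro ⟨⟨a, ha⟩, ⟨b, hb⟩⟩
    constructor
    · intro hab
      obtain rfl : a = b := add_neg_eq_zero.mp hab
      exact ⟨⟨a, ha, hb⟩, rfl⟩
    · rintro ⟨r, hr⟩
      rw [← hr]
      exact add_neg_cancel (r : C)
  surjective := fun c => by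
    obtain ⟨a, ha, b, hb, rfl⟩ := AddSubgroup.mem_sup.mp (h ▸ AddSubgroup.mem_top c)
    exact ⟨(⟨a, ha⟩, -⟨b, hb⟩), by simp⟩

end AbExtension

section Localizations

/-- The additive group of the localization `S⁻¹ℤ`: the rationals that have a denominator in the
submonoid `S` of `ℕ`. It is all of `ℚ` if `0 ∈ S`. -/
def ratLocalization (S : Submonoid ℕ) : AddSubgroup ℚ where
  carrier := {r | ∃ m ∈ S, ∃ k : ℤ, m * r = k}
  zero_mem' := ⟨1, S.one_mem, 0, by simp⟩
  add_mem' := by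
    rintro a b ⟨m, hm, k, h⟩ ⟨m', hm', k', h'⟩
    refine ⟨m * m', S.mul_mem hm hm', m' * k + m * k', ?_⟩
    push_cast
    linear_combination (m' : ℚ) * h + (m : ℚ) * h'
  neg_mem' := by
    rintro a ⟨m, hm, k, h⟩
    exact ⟨m, hm, -k, by push_cast; linear_combination -h⟩

variable {S T : Submonoid ℕ}

theorem intCast_mem_ratLocalization (S : Submonoid ℕ) (k : ℤ) : (k : ℚ) ∈ ratLocalization S :=
  ⟨1, S.one_mem, k, by simp⟩

theorem exists_nsmul_eq_ratLocalization {n : ℕ} (hn : n ∈ S) (h0 : n ≠ 0)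
    (r : ratLocalization S) : ∃ s : ratLocalization S, n • s = r := by
  have hn0 : (n : ℚ) ≠ 0 := Nat.cast_ne_zero.mpr h0
  obtain ⟨r, m, hm, k, h⟩ := r
  refine ⟨⟨r / n, m * n, S.mul_mem hm hn, k, ?_⟩, Subtype.ext ?_⟩
  · rw [← h, Nat.cast_mul, mul_assoc, mul_div_cancel₀ r hn0]
  · rw [AddSubgroup.coe_nsmul, nsmul_eq_mul, mul_div_cancel₀ r hn0]

theorem exists_intCast_mul_add_mul_eq_one {m n : ℕ} (h : m.Coprime n) :
    ∃ a b : ℤ, (a * m + b * n : ℚ) = 1 := by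
  obtain ⟨a, b, hab⟩ := Nat.isCoprime_iff_coprime.mpr h
  exact ⟨a, b, mod_cast hab⟩

theorem ratLocalization_inf_ratLocalization (hST : ∀ m ∈ S, ∀ n ∈ T, m.Coprime n) :
    ratLocalization S ⊓ ratLocalization T = (Int.castAddHom ℚ).range := by
  refine le_antisymm ?_ ?_
  · rintro r ⟨⟨m, hm, k, hk⟩, n, hn, l, hl⟩
    obtain ⟨a, b, hab⟩ := exists_intCast_mul_add_mul_eq_one (hST m hm n hn)
    refine ⟨a * k + b * l, ?_⟩
    rw [Int.coe_castAddHom]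
    push_cast
    linear_combination r * hab - (a : ℚ) * hk - (b : ℚ) * hl
  · rintro _ ⟨k, rfl⟩
    exact ⟨intCast_mem_ratLocalization S k, intCast_mem_ratLocalization T k⟩

theorem ratLocalization_sup_ratLocalization (hST : ∀ m ∈ S, ∀ n ∈ T, m.Coprime n)
    (hmul : ∀ d : ℕ, d ≠ 0 → ∃ m ∈ S, ∃ n ∈ T, d = m * n) :
    ratLocalization S ⊔ ratLocalization T = ⊤ := by
  refine eq_top_iff.mpr fun r _ => ?_
  obtain ⟨m, hm, n, hn, hd⟩ := hmul r.den r.den_nz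
  obtain ⟨a, b, hab⟩ := exists_intCast_mul_add_mul_eq_one (hST m hm n hn)
  have hr : (m * n : ℚ) * r = r.num := by
    rw [← Nat.cast_mul, ← hd, mul_comm, Rat.mul_den_eq_num]
  refine AddSubgroup.mem_sup.mpr ⟨b * n * r, ⟨m, hm, b * r.num, ?_⟩,
    a * m * r, ⟨n, hn, a * r.num, ?_⟩, ?_⟩
  · push_cast
    linear_combination (b : ℚ) * hr
  · push_cast
    linear_combination (a : ℚ) * hr
  · linear_combination r * hab

end Localizations

section DivisiblePart

variable {A : Type u} [AddCommGroup A] {S : Submonoid ℕ}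

variable (A S) in
/-- The largest subgroup `D` of `A` that is `S`-divisible, i.e. satisfies `n D = D` for every
nonzero `n ∈ S`. -/
def divisiblePart : AddSubgroup A :=
  sSup {D | ∀ n ∈ S, n ≠ 0 → D ≤ mulSubgroup n D}

theorem divisiblePart_le_mulSubgroup {n : ℕ} (hn : n ∈ S) (h0 : n ≠ 0) :
    divisiblePart A S ≤ mulSubgroup n (divisiblePart A S) :=
  sSup_le fun _ hD => (hD n hn h0).trans (mulSubgroup_mono n (le_sSup hD))

theorem range_le_divisiblePart (φ : ratLocalization S →+ A) : φ.range ≤ divisiblePart A S := by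
  refine le_sSup fun n hn h0 => ?_
  rintro _ ⟨r, rfl⟩
  obtain ⟨s, rfl⟩ := exists_nsmul_eq_ratLocalization hn h0 r
  exact ⟨φ s, ⟨s, rfl⟩, (map_nsmul φ n s).symm⟩

theorem divisiblePart_le_pPowSubgroup {p : ℕ} (hp : p ∈ S) (h0 : p ≠ 0) (o : Ordinal.{u}) :
    divisiblePart A S ≤ pPowSubgroup A p o :=
  le_transIter (mulSubgroup_mono p) (divisiblePart_le_mulSubgroup hp h0) o

end DivisiblePart

/-- The natural numbers prime to `n`, the denominators of `ℤ_(n)`. -/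
def coprimeSubmonoid (n : ℕ) : Submonoid ℕ where
  carrier := {m | n.Coprime m}
  one_mem' := Nat.coprime_one_right n
  mul_mem' := Nat.Coprime.mul_right

theorem coprime_of_mem_powers {p m n : ℕ} (hm : m ∈ Submonoid.powers p)
    (hn : n ∈ coprimeSubmonoid p) : m.Coprime n := by
  obtain ⟨k, rfl⟩ := hm
  exact Nat.Coprime.pow_left k hn

theorem exists_eq_mul_of_prime {p : ℕ} (hp : p.Prime) {d : ℕ} (hd : d ≠ 0) :
    ∃ m ∈ Submonoid.powers p, ∃ n ∈ coprimeSubmonoid p, d = m * n := by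
  obtain ⟨k, n, hn, rfl⟩ := Nat.exists_eq_pow_mul_and_not_dvd hd p hp.ne_one
  exact ⟨p ^ k, ⟨k, rfl⟩, n, hp.coprime_iff_not_dvd.mpr hn, rfl⟩

namespace IsCotorsion

variable {G : Type u} [AddCommGroup G]

theorem exists_extend (hG : IsCotorsion G) {A : Type} [AddCommGroup A] (E : AbExtension ℚ A)
    (φ : A →+ G) : ∃ ψ : E.B →+ G, ∀ a, ψ (E.f a) = φ a := by
  obtain ⟨ρ, hρ⟩ := (hG (E.pushout φ)).exists_retraction
  refine ⟨ρ.comp (E.toPushout φ), fun a => ?_⟩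
  rw [AddMonoidHom.comp_apply, E.toPushout_f, hρ]

theorem exists_eq_add_of_sup_eq_top (hG : IsCotorsion G) {P L : AddSubgroup ℚ} (h : P ⊔ L = ⊤)
    (φ : ↥(P ⊓ L) →+ G) :
    ∃ (α : P →+ G) (β : L →+ G), ∀ r : ↥(P ⊓ L), φ r = α ⟨r, r.2.1⟩ + β ⟨r, r.2.2⟩ := by
  obtain ⟨ψ, hψ⟩ := hG.exists_extend (AbExtension.ofSupEqTop P L h) φ
  refine ⟨ψ.comp (AddMonoidHom.inl P L), ψ.comp (AddMonoidHom.inr P L), fun r => ?_⟩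
  have hr : (AbExtension.ofSupEqTop P L h).f r =
      AddMonoidHom.inl P L ⟨r, r.2.1⟩ + AddMonoidHom.inr P L ⟨r, r.2.2⟩ :=
    (Prod.fst_add_snd _).symm
  rw [← hψ, hr]
  exact map_add ψ _ _

theorem divisiblePart_sup_divisiblePart (hG : IsCotorsion G) {S T : Submonoid ℕ}
    (hST : ∀ m ∈ S, ∀ n ∈ T, m.Coprime n)
    (hmul : ∀ d : ℕ, d ≠ 0 → ∃ m ∈ S, ∃ n ∈ T, d = m * n) :
    divisiblePart G S ⊔ divisiblePart G T = ⊤ := by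
  refine eq_top_iff.mpr fun x _ => ?_
  let e : ↥(ratLocalization S ⊓ ratLocalization T) ≃+ ℤ :=
    (AddEquiv.addSubgroupCongr (ratLocalization_inf_ratLocalization hST)).trans
      (AddMonoidHom.ofInjective (f := Int.castAddHom ℚ) Int.cast_injective).symm
  obtain ⟨α, β, h⟩ := hG.exists_eq_add_of_sup_eq_top
    (ratLocalization_sup_ratLocalization hST hmul) ((zmultiplesHom G x).comp e.toAddMonoidHom)
  have hx : ((zmultiplesHom G x).comp e.toAddMonoidHom) (e.symm 1) = x := by simp
  rw [← hx, h]
  exact AddSubgroup.add_mem_sup (range_le_divisiblePart α ⟨_, rfl⟩)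
    (range_le_divisiblePart β ⟨_, rfl⟩)

theorem pPowSubgroup_omega0_mul (hG : IsCotorsion G) {p : ℕ} (hp : p.Prime) (o : Ordinal.{u}) :
    pPowSubgroup G p (Ordinal.omega0 * o) =
      divisiblePart G (Submonoid.powers p) ⊔ ulmSubgroup G o := by
  set D := divisiblePart G (Submonoid.powers p)
  set K := divisiblePart G (coprimeSubmonoid p)
  have hD : D ≤ pPowSubgroup G p (Ordinal.omega0 * o) :=
    divisiblePart_le_pPowSubgroup (Submonoid.mem_powers p) hp.ne_zero _
  have hK : K ⊓ pPowSubgroup G p (Ordinal.omega0 * o) ≤ ulmSubgroup G o := by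
    rw [ulmSubgroup_eq_iInf_pPowSubgroup]
    refine le_iInf₂ fun q hq => ?_
    rcases eq_or_ne p q with rfl | hpq
    · exact inf_le_right
    · exact inf_le_left.trans
        (divisiblePart_le_pPowSubgroup ((Nat.coprime_primes hp hq).mpr hpq) hq.ne_zero _)
  have hDK : D ⊔ K = ⊤ := hG.divisiblePart_sup_divisiblePart
    (fun _ hm _ hn => coprime_of_mem_powers hm hn) fun _ hd => exists_eq_mul_of_prime hp hd
  refine le_antisymm ?_ (sup_le hD (ulmSubgroup_le_pPowSubgroup hp o))
  calc pPowSubgroup G p (Ordinal.omega0 * o)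
      = (D ⊔ K) ⊓ pPowSubgroup G p (Ordinal.omega0 * o) := by rw [hDK, top_inf_eq]
    _ = D ⊔ K ⊓ pPowSubgroup G p (Ordinal.omega0 * o) := sup_inf_assoc_of_le K hD
    _ ≤ D ⊔ ulmSubgroup G o := sup_le_sup_left hK D

theorem pLength_le_of_ulmLength_le (hG : IsCotorsion G) {o : Ordinal.{u}} (h : ulmLength G ≤ o)
    {p : ℕ} (hp : p.Prime) : pLength G p ≤ Ordinal.omega0 * o := by
  have hU : ulmSubgroup G o ≤ mulSubgroup p (ulmSubgroup G o) := by
    conv_lhs => rw [← ulmLength_le_iff.mp h, ulmSubgroup_add_one]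
    exact iInf₂_le p hp.one_le
  rw [pLength_le_iff, pPowSubgroup_add_one, hG.pPowSubgroup_omega0_mul hp]
  refine le_antisymm (mulSubgroup_le p _) (sup_le ?_ ?_)
  · exact (divisiblePart_le_mulSubgroup (Submonoid.mem_powers p) hp.ne_zero).trans
      (mulSubgroup_mono p le_sup_left)
  · exact hU.trans (mulSubgroup_mono p le_sup_right)

end IsCotorsion

theorem propositionp (G : Type u) [AddCommGroup G] (hG : IsCotorsion G) (l : Ordinal.{u}) :
    ulmLength G ≤ l ↔ ∀ p : ℕ, p.Prime → pLength G p ≤ Ordinal.omega0 * l :=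
  ⟨fun h _ hp => hG.pLength_le_of_ulmLength_le h hp, ulmLength_le_of_forall_pLength_le⟩
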